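/- Let $n\in\mathbb{N}$, $\gamma>0$, and write the elements of $\mathbb{R}^{n^2}=\mathbb{R}^n\times\mathbb{R}^{n(n-1)}$ as $(x,z)=((x_i)_i,(z_{ij})_{i\neq j})$, with the supremum norm $\|\cdot\|$. Let $C_\gamma$ be the space of continuous functions $u:(-\infty,0]\to\mathbb{R}^{n^2}$ for which $\lim_{s\to-\infty}e^{\gamma s}u(s)$ exists in $\mathbb{R}^{n^2}$, with the norm $\|u\|_\gamma=\sup_{s\le 0}e^{\gamma s}\|u(s)\|$, and let $u_t(s)=u(t+s)$, $s\le 0$, denote the history of $u$ up to time $t$. For all $i,j\in\{1,\dots,n\}$ with $i\neq j$, let $A_i,B_{ij},I_i:\mathbb{R}\to\mathbb{R}$ be functions, $\Gamma_i\in\mathbb{R}$, $c_{ij},d_{ij}\ge 0$, and let $\mu_{ij}$ be a positive regular Borel measure on $(-\infty,0]$. Assume: (D) all $A_i$, $B_{ij}$ are locally Lipschitz continuous and, for some $\alpha>0$, $A_i(s)\ge\alpha$ and $B_{ij}(s)\ge\alpha$ for all $s\in\mathbb{R}$ and all $i\neq j$; (M) $\int_{-\infty}^0 e^{-\gamma\tau}\,d\mu_{ij}(\tau)<\infty$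 for all $i\neq j$; (I) every $I_i$ is continuous. Put $b(0)=0$ and $b(\varepsilon)=\varepsilon\log\frac{1-\varepsilon}{\varepsilon}$ for $\varepsilon\in(0,1)$, and $$\chi_\varepsilon(s)=\begin{cases}[0,\varepsilon],& s<-b(\varepsilon),\\ [0,1],& -b(\varepsilon)\le s\le b(\varepsilon),\\ [1-\varepsilon,1],& s>b(\varepsilon).\end{cases}$$ For $u=(x,z)\in C_\gamma$ set $D(u)=\big((-A_i(x_i(0))x_i(0))_i,(-B_{ij}(z_{ij}(0))z_{ij}(0))_{i\ne j}\big)$, $I(t)=((I_i(t))_i,0)$, and $$X^\varepsilon(u)=\prod_{i}\Big(\sum_{k\neq i}(z_{ki}(0)-c_{ki})\int_{-\infty}^0\chi_\varepsilon(x_k(\tau)-\Gamma_k)\,d\mu_{ki}(\tau)\Big)\times\prod_{i\neq j}\Big(d_{ij}\,\max\{x_j(0),0\}\int_{-\infty}^0\chi_\varepsilon(x_i(\tau)-\Gamma_i)\,d\mu_{ij}(\tau)\Big),$$ where the integrals are Aumann integrals (the set of integrals of all integrable selectors) and the sums are Minkowski sums. For $T>0$, a solution on $[t_0,t_0+T]$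 of the $\varepsilon$-inflated inclusion $$u'(t)\in D(u_t)+X^\varepsilon(u_t)+I(t)$$ with initial datum $\varphi\in C_\gamma$ at $t_0$ is a function $u:(-\infty,t_0+T]\to\mathbb{R}^{n^2}$ with $u_{t_0}=\varphi$ that is absolutely continuous on $[t_0,t_0+T]$ and satisfies the inclusion for almost every $t\in[t_0,t_0+T]$. Theorem. Let $t_0\in\mathbb{R}$, $T>0$, $r>0$, and let $\{\varepsilon_m\}_{m\ge1}\subset[0,\frac15]$ be a nonincreasing sequence with limit $\varepsilon_0$. Let $\{u_0^m\}_m\subset C_\gamma$ satisfy $\|u_0^m\|_\gamma\le r$ for all $m$ and converge in $C_\gamma$ to $u_0\in C_\gamma$. For each $m$, let $u^{\varepsilon_m}$ be a solution on $[t_0,t_0+T]$ of the $\varepsilon_m$-inflated inclusion with initial datum $u_0^m$ at $t_0$. Then there are a subsequence $\{u^{\varepsilon_{m_k}}\}_k$ and a function $u^*:(-\infty,t_0+T]\to\mathbb{R}^{n^2}$, continuous on $[t_0,t_0+T]$, such that $u^{\varepsilon_{m_k}}\to u^*$ uniformly on $[t_0,t_0+T]$ and $u^*$ is a solution on $[t_0,t_0+T]$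 of the $\varepsilon_0$-inflated inclusion with initial datum $u_0$ at $t_0$. -/

import Mathlib

open MeasureTheory Filter Topology Set
open scoped Pointwise

noncomputable section

namespace DelayNetwork

/-- The past time half-line `(-∞, 0]`. -/
abbrev Past : Type := Set.Iic (0 : ℝ)

/-- The time `0`, as a point of `(-∞, 0]`. -/
def now : Past := ⟨0, Set.mem_Iic.2 le_rfl⟩

/-- Ordered pairs `(i, j)` of indices with `i ≠ j`. -/
abbrev OffDiag (n : ℕ) : Type := {p : Fin n × Fin n // p.1 ≠ p.2}

/-- The state space `ℝ^n × ℝ^(n(n-1))`, with elements `(x, z) = ((x_i)_i, (z_ij)_{i ≠ j})`.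
Its norm (that of products and finite powers in Mathlib) is the supremum norm. -/
abbrev State (n : ℕ) : Type := (Fin n → ℝ) × (OffDiag n → ℝ)

/-- The history `u_t : (-∞, 0] → E`, `s ↦ u (t + s)`. Only the values of `u` on `(-∞, t]`
matter. -/
def history {E : Type*} (u : ℝ → E) (t : ℝ) : Past → E := fun s => u (t + s)

/-- The phase space `C_γ`: the continuous functions `u : (-∞, 0] → E` for which `e^{γ s} u(s)`
has a limit in `E` as `s → -∞`. -/
def CGamma (γ : ℝ) (E : Type*) [NormedAddCommGroup E] [NormedSpace ℝ E] :
    Submodule ℝ (Past → E) where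
  carrier := {u | Continuous u ∧
    ∃ l : E, Tendsto (fun s : Past => Real.exp (γ * s) • u s) atBot (𝓝 l)}
  zero_mem' := ⟨continuous_const, 0, by simp⟩
  add_mem' := by
    rintro u v ⟨hu, l, hl⟩ ⟨hv, l', hl'⟩
    refine ⟨hu.add hv, l + l', ?_⟩
    simpa [smul_add] using hl.add hl'
  smul_mem' := by
    rintro a u ⟨hu, l, hl⟩
    refine ⟨hu.const_smul a, a • l, ?_⟩
    simpa [smul_comm a] using hl.const_smul a

/-- The norm `‖u‖_γ = sup_{s ≤ 0} e^{γ s} ‖u(s)‖` of `C_γ`. -/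
def gammaNorm {γ : ℝ} {E : Type*} [NormedAddCommGroup E] [NormedSpace ℝ E]
    (u : CGamma γ E) : ℝ :=
  ⨆ s : Past, Real.exp (γ * s) * ‖(u : Past → E) s‖

/-- The supremum in the definition of `gammaNorm` is that of a bounded set. -/
theorem bddAbove_gammaNorm {γ : ℝ} {E : Type*} [NormedAddCommGroup E] [NormedSpace ℝ E]
    (u : CGamma γ E) :
    BddAbove (Set.range fun s : Past => Real.exp (γ * s) * ‖(u : Past → E) s‖) := by
  obtain ⟨hu, l, hl⟩ := u.2
  have h1 : Tendsto (fun s : Past => Real.exp (γ * s) * ‖(u : Past → E) s‖) atBot (𝓝 ‖l‖) := by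
    refine hl.norm.congr fun s => ?_
    rw [norm_smul, Real.norm_eq_abs, abs_of_pos (Real.exp_pos _)]
  have h2 : ∀ᶠ s : Past in atBot, Real.exp (γ * s) * ‖(u : Past → E) s‖ ≤ ‖l‖ + 1 :=
    h1.eventually (eventually_le_nhds (by linarith))
  obtain ⟨a, ha⟩ := eventually_atBot.1 h2
  have hc : Continuous fun s : Past => Real.exp (γ * s) * ‖(u : Past → E) s‖ := by
    have := hu.norm
    fun_prop
  have hK : IsCompact (Set.Icc a now) := by
    have : Set.Icc a now = Subtype.val ⁻¹' (Set.Icc (a : ℝ) 0) := by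
      ext s
      exact ⟨fun h => ⟨h.1, Set.mem_Iic.1 s.2⟩, fun h => ⟨h.1, Set.mem_Iic.1 s.2⟩⟩
    rw [this]
    refine (isClosed_Iic.isClosedEmbedding_subtypeVal).isCompact_preimage isCompact_Icc
  obtain ⟨C, hC⟩ := (hK.image hc).bddAbove
  refine ⟨max C (‖l‖ + 1), ?_⟩
  rintro _ ⟨s, rfl⟩
  rcases le_total s a with h | h
  · exact (ha s h).trans (le_max_right _ _)
  · exact (hC ⟨s, ⟨h, Set.mem_Iic.1 s.2⟩, rfl⟩).trans (le_max_left _ _)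

/-- The Aumann integral of a set-valued function `F` on `(-∞, 0]`: the set of the integrals of
its integrable selectors. -/
def aumannIntegral (F : Past → Set ℝ) (μ : Measure Past) : Set ℝ :=
  {y | ∃ s : Past → ℝ, (∀ τ, s τ ∈ F τ) ∧ Integrable s μ ∧ ∫ τ, s τ ∂μ = y}

/-- The threshold `b(ε) = ε log((1 - ε)/ε)` for `ε ∈ (0, 1)`, and `b(0) = 0`. -/
def threshold (ε : ℝ) : ℝ := if ε = 0 then 0 else ε * Real.log ((1 - ε) / ε)

/-- The inflated Heaviside multifunction `χ_ε`. -/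
def chi (ε s : ℝ) : Set ℝ :=
  if s < -threshold ε then Set.Icc 0 ε
  else if s ≤ threshold ε then Set.Icc 0 1
  else Set.Icc (1 - ε) 1

/-- The data of the neural network: decay rates `A_i`, `B_ij`, thresholds `Γ_i`, nonnegative
constants `c_ij`, `d_ij`, positive regular Borel measures `μ_ij` on `(-∞, 0]`, and stimuli
`I_i`. -/
structure Network (n : ℕ) where
  A : Fin n → ℝ → ℝ
  B : OffDiag n → ℝ → ℝ
  Γ : Fin n → ℝ
  c : OffDiag n → ℝ
  d : OffDiag n → ℝ
  c_nonneg : ∀ p, 0 ≤ c p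
  d_nonneg : ∀ p, 0 ≤ d p
  μ : OffDiag n → Measure Past
  μ_regular : ∀ p, (μ p).Regular
  stim : Fin n → ℝ → ℝ

namespace Network

variable {n : ℕ}

/-- Hypothesis (D): `A_i` and `B_ij` are locally Lipschitz and bounded below by a common
`α > 0`. -/
def HypD (N : Network n) : Prop :=
  (∀ i, LocallyLipschitz (N.A i)) ∧ (∀ p, LocallyLipschitz (N.B p)) ∧
    ∃ α : ℝ, 0 < α ∧ (∀ i s, α ≤ N.A i s) ∧ ∀ p s, α ≤ N.B p s

/-- Hypothesis (M): `∫ e^{-γ τ} dμ_ij(τ) < ∞`. -/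
def HypM (N : Network n) (γ : ℝ) : Prop :=
  ∀ p, ∫⁻ τ : Past, ENNReal.ofReal (Real.exp (-γ * τ)) ∂(N.μ p) < ⊤

/-- Hypothesis (I): the stimuli `I_i` are continuous. -/
def HypI (N : Network n) : Prop := ∀ i, Continuous (N.stim i)

/-- The decay term `D(x, z) = ((-A_i(x_i(0)) x_i(0))_i, (-B_ij(z_ij(0)) z_ij(0))_ij)`. -/
def decay (N : Network n) (u : Past → State n) : State n :=
  (fun i => -N.A i ((u now).1 i) * (u now).1 i,
   fun p => -N.B p ((u now).2 p) * (u now).2 p)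

/-- The stimuli term `I(t) = ((I_i(t))_i, 0)`. -/
def stimuli (N : Network n) (t : ℝ) : State n := (fun i => N.stim i t, 0)

/-- The Aumann integral `∫ χ_ε(x_i(τ) - Γ_i) dμ_ij(τ)`, for `p = (i, j)`. -/
def signal (N : Network n) (ε : ℝ) (u : Past → State n) (p : OffDiag n) : Set ℝ :=
  aumannIntegral (fun τ => chi ε ((u τ).1 p.1.1 - N.Γ p.1.1)) (N.μ p)

/-- The set-valued excitation and inhibition term `X^ε(x, z)`, a product of subsets of `ℝ`:
its `i`-th factor is the Minkowski sum `∑_{k ≠ i} (z_ki(0) - c_ki) ∫ χ_ε(x_k - Γ_k) dμ_ki`, and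
its `(i, j)`-th factor is `d_ij [x_j(0)]^+ ∫ χ_ε(x_i - Γ_i) dμ_ij`. -/
def inflatedTerm (N : Network n) (ε : ℝ) (u : Past → State n) : Set (State n) :=
  (Set.univ.pi fun i : Fin n =>
    ∑ k : {k : Fin n // k ≠ i},
      ((u now).2 ⟨(k, i), k.2⟩ - N.c ⟨(k, i), k.2⟩) • N.signal ε u ⟨(k, i), k.2⟩) ×ˢ
  (Set.univ.pi fun p : OffDiag n =>
    (N.d p * max ((u now).1 p.1.2) 0) • N.signal ε u p)

/-- `u` is a solution on `[t₀, t₀ + T]` of the inclusion `u'(t) ∈ D(u_t) + X^ε(u_t) + I(t)` with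
initial datum `u_{t₀} = φ`: it is absolutely continuous on `[t₀, t₀ + T]`, its history at `t₀`
is `φ`, and the inclusion holds at almost every `t ∈ [t₀, t₀ + T]`. Only the values of `u` on
`(-∞, t₀ + T]` matter. -/
def IsSolution (N : Network n) (ε t₀ T : ℝ) (φ : Past → State n) (u : ℝ → State n) : Prop :=
  history u t₀ = φ ∧
  AbsolutelyContinuousOnInterval u t₀ (t₀ + T) ∧
  ∀ᵐ t ∂(volume.restrict (Set.Icc t₀ (t₀ + T))),
    ∃ v ∈ {N.decay (history u t)} + N.inflatedTerm ε (history u t) + {N.stimuli t},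
      HasDerivAt u v t

end Network

end DelayNetwork

end

/-!
Both ends of the interval `chi ε s` have the semicontinuity that makes the inflated Heaviside
multifunction upper semicontinuous, jointly in `ε` and `s` (`tendsto_max_chiUpper`,
`tendsto_min_chiLower`). Its Aumann integral against a finite measure is the compact interval
between the integrals of the ends (`aumannIntegral_chi`), and dominated convergence makes it upper
semicontinuous along pointwise convergent histories (`tendstoUpper_aumannIntegral_chi`). As the
right-hand side of the inclusion is a product of subsets of `ℝ`, one for each coordinate, it is a
product of compact intervals that depends upper semicontinuously on `ε`, on the time and on the
history (`tendstoUpper_rhs`).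

The decay is dissipative and the other terms grow at most linearly, so Grönwall's inequality bounds
the solutions uniformly (`exists_solution_bound`); they are then uniformly Lipschitz
(`exists_solution_lipschitz`), and the Arzelà–Ascoli theorem gives a uniformly convergent
subsequence with a Lipschitz limit, extended to the past by the limit of the initial data.

That the limit solves the limiting inclusion needs neither weak compactness of the derivatives nor
measurable selections (`hasDerivAt_mem_of_tendstoUpper`): membership in a compact interval amounts
to two inequalities, and a one-sided bound on the derivatives of the approximating solutions near
`t` bounds their increments, hence the increments of the limit, hence its derivative at `t`.
-/

namespace DelayNetwork

/-! ### Absolutely continuous functions with one-sided bounds on the derivative -/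

theorem _root_.LipschitzWith.comp_absolutelyContinuousOnInterval {X Y : Type*}
    [PseudoMetricSpace X] [PseudoMetricSpace Y] {K : NNReal} {g : X → Y} {f : ℝ → X} {a b : ℝ}
    (hg : LipschitzWith K g) (hf : AbsolutelyContinuousOnInterval f a b) :
    AbsolutelyContinuousOnInterval (g ∘ f) a b := by
  unfold AbsolutelyContinuousOnInterval at hf ⊢
  refine squeeze_zero (fun E => Finset.sum_nonneg fun i _ => dist_nonneg) (fun E => ?_)
    (by simpa using hf.const_mul (K : ℝ))
  rw [Finset.mul_sum]
  exact Finset.sum_le_sum fun i _ => hg.dist_le_mul _ _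

theorem absolutelyContinuousOnInterval_sum {κ : Type*} {s : Finset κ} {f : κ → ℝ → ℝ} {a b : ℝ}
    (h : ∀ k ∈ s, AbsolutelyContinuousOnInterval (f k) a b) :
    AbsolutelyContinuousOnInterval (fun t => ∑ k ∈ s, f k t) a b := by
  classical
  induction s using Finset.induction_on with
  | empty =>
    simp only [Finset.sum_empty]
    exact ((LipschitzWith.const (0 : ℝ)).lipschitzOnWith).absolutelyContinuousOnInterval
  | insert k s hk ih =>
    simp only [Finset.sum_insert hk]
    exact (h k (Finset.mem_insert_self _ _)).fun_add
      (ih fun j hj => h j (Finset.mem_insert_of_mem hj))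

theorem sub_le_of_ae_hasDerivAt_le {y : ℝ → ℝ} {a b C : ℝ} (hab : a ≤ b)
    (hy : AbsolutelyContinuousOnInterval y a b)
    (h : ∀ᵐ t, t ∈ Icc a b → ∃ v ≤ C, HasDerivAt y v t) : y b - y a ≤ C * (b - a) := by
  rw [← hy.integral_deriv_eq_sub]
  have h1 : ∫ _ in a..b, C = C * (b - a) := by simp [mul_comm]
  rw [← h1]
  refine intervalIntegral.integral_mono_ae_restrict hab hy.intervalIntegrable_deriv
    intervalIntegrable_const ?_
  refine (ae_restrict_iff' measurableSet_Icc).2 ?_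
  filter_upwards [h] with t ht hmem
  obtain ⟨v, hv, hd⟩ := ht hmem
  simpa [hd.deriv] using hv

/-- Grönwall's inequality for absolutely continuous functions. -/
theorem le_mul_exp_of_ae_hasDerivAt_le {V : ℝ → ℝ} {a b K : ℝ} (hab : a ≤ b)
    (hV : AbsolutelyContinuousOnInterval V a b)
    (h : ∀ᵐ t, t ∈ Icc a b → ∃ v ≤ K * V t, HasDerivAt V v t) :
    V b ≤ V a * Real.exp (K * (b - a)) := by
  have hexp : AbsolutelyContinuousOnInterval (fun t => Real.exp (-K * (t - a))) a b := by
    refine ContDiffOn.absolutelyContinuousOnInterval (ContDiff.contDiffOn ?_)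
    fun_prop
  have key := sub_le_of_ae_hasDerivAt_le (C := 0) hab (hV.fun_mul hexp) (by
    filter_upwards [h] with t ht hmem
    obtain ⟨v, hv, hd⟩ := ht hmem
    have he : HasDerivAt (fun t => Real.exp (-K * (t - a))) (Real.exp (-K * (t - a)) * -K) t := by
      have := (((hasDerivAt_id t).sub_const a).const_mul (-K)).exp
      simpa using this
    refine ⟨_, ?_, hd.mul he⟩
    have := Real.exp_pos (-K * (t - a))
    nlinarith)
  have h2 : V b * Real.exp (-K * (b - a)) ≤ V a := by simpa using key
  have h3 := mul_le_mul_of_nonneg_right h2 (Real.exp_pos (K * (b - a))).le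
  rwa [mul_assoc, ← Real.exp_add, neg_mul, neg_add_cancel, Real.exp_zero, mul_one] at h3

theorem abs_sub_le_of_ae_hasDerivAt {y : ℝ → ℝ} {a b C : ℝ} (hab : a ≤ b)
    (hy : AbsolutelyContinuousOnInterval y a b)
    (h : ∀ᵐ t, t ∈ Icc a b → ∃ v, |v| ≤ C ∧ HasDerivAt y v t) :
    |y b - y a| ≤ C * (b - a) := by
  have h1 := sub_le_of_ae_hasDerivAt_le (C := C) hab hy (by
    filter_upwards [h] with t ht hmem
    obtain ⟨v, hv, hd⟩ := ht hmem
    exact ⟨v, (abs_le.1 hv).2, hd⟩)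
  have h2 := sub_le_of_ae_hasDerivAt_le (C := C) hab hy.neg (by
    filter_upwards [h] with t ht hmem
    obtain ⟨v, hv, hd⟩ := ht hmem
    exact ⟨-v, by linarith [(abs_le.1 hv).1], hd.neg⟩)
  simp only [Pi.neg_apply] at h2
  exact abs_le.2 ⟨by linarith, h1⟩

/-! ### Upper limits of families of sets -/

/-- The sets `F i` are eventually contained in every closed `η`-neighbourhood of `S`: convergence
in the sense of the Hausdorff semidistance, the one relevant to upper semicontinuity. -/
def TendstoUpper {ι : Type*} (l : Filter ι) (F : ι → Set ℝ) (S : Set ℝ) : Prop :=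
  ∀ η > 0, ∀ᶠ i in l, ∀ v ∈ F i, ∃ w ∈ S, |v - w| ≤ η

namespace TendstoUpper

variable {ι : Type*} {l : Filter ι} {F G : ι → Set ℝ} {S R : Set ℝ}

theorem singleton {a : ι → ℝ} {a₀ : ℝ} (h : Tendsto a l (𝓝 a₀)) :
    TendstoUpper l (fun i => {a i}) {a₀} := by
  intro η hη
  filter_upwards [Metric.tendsto_nhds.1 h η hη] with i hi v hv
  rw [mem_singleton_iff] at hv
  subst hv
  exact ⟨a₀, rfl, hi.le⟩

theorem add (hF : TendstoUpper l F S) (hG : TendstoUpper l G R) :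
    TendstoUpper l (fun i => F i + G i) (S + R) := by
  intro η hη
  filter_upwards [hF (η / 2) (half_pos hη), hG (η / 2) (half_pos hη)] with i h1 h2 v hv
  obtain ⟨x, hx, y, hy, rfl⟩ := Set.mem_add.1 hv
  obtain ⟨x', hx', hxx⟩ := h1 x hx
  obtain ⟨y', hy', hyy⟩ := h2 y hy
  refine ⟨x' + y', Set.add_mem_add hx' hy', ?_⟩
  calc |x + y - (x' + y')| = |(x - x') + (y - y')| := by congr 1; ring
    _ ≤ |x - x'| + |y - y'| := abs_add_le _ _
    _ ≤ η := by linarith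

theorem sum {κ : Type*} {s : Finset κ} {F : κ → ι → Set ℝ} {S : κ → Set ℝ}
    (h : ∀ k ∈ s, TendstoUpper l (F k) (S k)) :
    TendstoUpper l (fun i => ∑ k ∈ s, F k i) (∑ k ∈ s, S k) := by
  classical
  induction s using Finset.induction_on with
  | empty =>
    intro η hη
    refine Eventually.of_forall fun i v hv => ⟨v, by simpa using hv, by simpa using hη.le⟩
  | insert k s hk ih =>
    simp only [Finset.sum_insert hk]
    exact (h k (Finset.mem_insert_self _ _)).add
      (ih fun j hj => h j (Finset.mem_insert_of_mem hj))

theorem smul {a : ι → ℝ} {a₀ : ℝ} (ha : Tendsto a l (𝓝 a₀)) (hF : TendstoUpper l F S)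
    (hS : Bornology.IsBounded S) : TendstoUpper l (fun i => a i • F i) (a₀ • S) := by
  intro η hη
  obtain ⟨C, hC0, hC⟩ := hS.exists_pos_norm_le
  have hδ : 0 < η / 2 / (|a₀| + 1) := by positivity
  have hδ' : 0 < min 1 (η / 2 / C) := by positivity
  filter_upwards [hF _ hδ, Metric.tendsto_nhds.1 ha _ hδ'] with i h1 h2 v hv
  obtain ⟨x, hx, rfl⟩ := Set.mem_smul_set.1 hv
  obtain ⟨x', hx', hxx⟩ := h1 x hx
  refine ⟨a₀ • x', Set.smul_mem_smul_set hx', ?_⟩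
  rw [Real.dist_eq] at h2
  have h3 : |a i - a₀| * C ≤ η / 2 := by
    rw [← le_div_iff₀ hC0]; exact (h2.le).trans (min_le_right _ _)
  have h4 : |a i| ≤ |a₀| + 1 := by
    have := abs_sub_abs_le_abs_sub (a i) a₀
    linarith [h2.le.trans (min_le_left _ _)]
  have h5 : |x - x'| * (|a₀| + 1) ≤ η / 2 := by rwa [← le_div_iff₀ (by positivity)]
  have h6 : |x'| ≤ C := hC x' hx'
  calc |a i • x - a₀ • x'| = |a i * (x - x') + (a i - a₀) * x'| := by
        simp only [smul_eq_mul]; congr 1; ring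
    _ ≤ |a i| * |x - x'| + |a i - a₀| * |x'| := by
        rw [← abs_mul, ← abs_mul]; exact abs_add_le _ _
    _ ≤ (|a₀| + 1) * |x - x'| + |a i - a₀| * C := by gcongr
    _ ≤ η := by linarith

end TendstoUpper

/-- A one-sided bound on the derivatives of `Y m`, near `t` and for large `m`, passes to the
derivative at `t` of the pointwise limit. -/
theorem hasDerivAt_le_of_tendsto {Y : ℕ → ℝ → ℝ} {y : ℝ → ℝ} {a b t v c : ℝ} (ht : t ∈ Ioo a b)
    (hY : ∀ m, AbsolutelyContinuousOnInterval (Y m) a b)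
    (hlim : ∀ s ∈ Icc a b, Tendsto (fun m => Y m s) atTop (𝓝 (y s)))
    (hv : HasDerivAt y v t) {P : ℕ → ℝ → ℝ → Prop}
    (hP : ∀ m, ∀ᵐ s, s ∈ Icc a b → ∃ w, P m s w ∧ HasDerivAt (Y m) w s)
    (hle : ∀ᶠ p : ℕ × ℝ in atTop ×ˢ 𝓝 t, ∀ w, P p.1 p.2 w → w ≤ c) : v ≤ c := by
  obtain ⟨p, hp, q, hq, hpq⟩ := eventually_prod_iff.1 hle
  obtain ⟨δ, hδ, hball⟩ := Metric.eventually_nhds_iff.1 hq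
  have hslope : Tendsto (slope y t) (𝓝[>] t) (𝓝 v) :=
    (hasDerivAt_iff_tendsto_slope.1 hv).mono_left (nhdsWithin_mono _ fun s hs => ne_of_gt hs)
  refine le_of_tendsto hslope ?_
  have hmem : Ioo t (min b (t + δ)) ∈ 𝓝[>] t :=
    Ioo_mem_nhdsGT (lt_min ht.2 (by linarith))
  filter_upwards [hmem] with s hs
  have hsb : s < b := hs.2.trans_le (min_le_left _ _)
  have hsδ : s < t + δ := hs.2.trans_le (min_le_right _ _)
  have hsub : Icc t s ⊆ Icc a b := Icc_subset_Icc ht.1.le hsb.le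
  have key : ∀ᶠ m in atTop, Y m s - Y m t ≤ c * (s - t) := by
    filter_upwards [hp] with m hm
    refine sub_le_of_ae_hasDerivAt_le hs.1.le ((hY m).mono ?_) ?_
    · rwa [uIcc_of_le hs.1.le, uIcc_of_le (ht.1.trans ht.2).le]
    · filter_upwards [hP m] with x hx hxm
      obtain ⟨w, hw, hd⟩ := hx (hsub hxm)
      refine ⟨w, hpq hm (hball ?_) w hw, hd⟩
      rw [Real.dist_eq, abs_of_nonneg (by linarith [hxm.1])]
      linarith [hxm.2]
  have hl := le_of_tendsto ((hlim s (hsub (right_mem_Icc.2 hs.1.le))).sub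
    (hlim t (hsub (left_mem_Icc.2 hs.1.le)))) key
  rw [slope_def_field, div_le_iff₀ (by linarith [hs.1])]
  exact hl

/-- Closure of scalar differential inclusions under pointwise limits: if `(Y m)' ∈ F m` a.e. and
the sets `F m s` converge from above to a compact convex set `S` as `m → ∞` and `s → t`, then
the derivative at `t` of the limit lies in `S`. Since `S` is an interval, it is enough to pass to
the limit in the two inequalities that describe it. -/
theorem hasDerivAt_mem_of_tendstoUpper {Y : ℕ → ℝ → ℝ} {y : ℝ → ℝ} {a b t v : ℝ}
    (ht : t ∈ Ioo a b) (hY : ∀ m, AbsolutelyContinuousOnInterval (Y m) a b)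
    (hlim : ∀ s ∈ Icc a b, Tendsto (fun m => Y m s) atTop (𝓝 (y s)))
    (hv : HasDerivAt y v t) {F : ℕ → ℝ → Set ℝ} {S : Set ℝ}
    (hF : ∀ m, ∀ᵐ s, s ∈ Icc a b → ∃ w ∈ F m s, HasDerivAt (Y m) w s)
    (hS : IsCompact S) (hSc : Convex ℝ S) (hS0 : S.Nonempty)
    (hup : TendstoUpper (atTop ×ˢ 𝓝 t) (fun p : ℕ × ℝ => F p.1 p.2) S) : v ∈ S := by
  rw [eq_Icc_of_connected_compact ⟨hS0, hSc.isPreconnected⟩ hS]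
  constructor
  · refine le_of_forall_pos_le_add fun η hη => ?_
    have := hasDerivAt_le_of_tendsto (Y := fun m => -Y m) (y := -y) (v := -v)
      (c := η - sInf S) ht (fun m => (hY m).neg) (fun s hs => (hlim s hs).neg) hv.neg
      (P := fun m s w => -w ∈ F m s) (fun m => by
        filter_upwards [hF m] with s hs hmem
        obtain ⟨w, hw, hd⟩ := hs hmem
        exact ⟨-w, by simpa using hw, hd.neg⟩) (by
        filter_upwards [hup η hη] with p hp w hw
        obtain ⟨w', hw', hd⟩ := hp _ hw
        have := csInf_le hS.bddBelow hw'
        linarith [(abs_le.1 hd).1])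
    linarith
  · refine le_of_forall_pos_le_add fun η hη => ?_
    refine hasDerivAt_le_of_tendsto ht hY hlim hv (P := fun m s w => w ∈ F m s) hF ?_
    filter_upwards [hup η hη] with p hp w hw
    obtain ⟨w', hw', hd⟩ := hp _ hw
    have := le_csSup hS.bddAbove hw'
    linarith [(abs_le.1 hd).2]

/-! ### The inflated Heaviside multifunction -/

/-- With `Real.log 0 = 0`, one formula covers `ε = 0` too; continuity at `0` is then that of
`ε log ε`. -/
theorem threshold_eq {ε : ℝ} (h : ε < 1) :
    threshold ε = ε * Real.log (1 - ε) - ε * Real.log ε := by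
  unfold threshold
  split_ifs with h0
  · simp [h0]
  · rw [Real.log_div (by linarith) h0]; ring

theorem threshold_nonneg {ε : ℝ} (h : ε ∈ Icc (0 : ℝ) (1 / 5)) : 0 ≤ threshold ε := by
  unfold threshold
  split_ifs with h0
  · rfl
  · have hpos : 0 < ε := lt_of_le_of_ne h.1 (Ne.symm h0)
    refine mul_nonneg h.1 (Real.log_nonneg ?_)
    rw [le_div_iff₀ hpos]
    linarith [h.2]

theorem tendsto_threshold {ι : Type*} {l : Filter ι} {ε : ι → ℝ} {ε₀ : ℝ} (h₀ : ε₀ < 1)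
    (h : Tendsto ε l (𝓝 ε₀)) : Tendsto (fun i => threshold (ε i)) l (𝓝 (threshold ε₀)) := by
  rw [threshold_eq h₀]
  have h1 : Tendsto (fun i => ε i * Real.log (1 - ε i) - ε i * Real.log (ε i)) l
      (𝓝 (ε₀ * Real.log (1 - ε₀) - ε₀ * Real.log ε₀)) :=
    (h.mul ((h.const_sub 1).log (by linarith))).sub
      ((Real.continuous_mul_log.tendsto ε₀).comp h)
  refine h1.congr' ?_
  filter_upwards [h.eventually (gt_mem_nhds h₀)] with i hi
  exact (threshold_eq hi).symm

/-- The lower end of the interval `chi ε s`. -/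
noncomputable def chiLower (ε s : ℝ) : ℝ := if s ≤ threshold ε then 0 else 1 - ε

/-- The upper end of the interval `chi ε s`. -/
noncomputable def chiUpper (ε s : ℝ) : ℝ := if s < -threshold ε then ε else 1

theorem chi_eq_Icc {ε : ℝ} (hε : ε ∈ Icc (0 : ℝ) (1 / 5)) (s : ℝ) :
    chi ε s = Icc (chiLower ε s) (chiUpper ε s) := by
  have := threshold_nonneg hε
  unfold chi chiLower chiUpper
  split_ifs <;> first | rfl | (exfalso; linarith)

theorem chiLower_le_chiUpper {ε : ℝ} (hε : ε ∈ Icc (0 : ℝ) (1 / 5)) (s : ℝ) :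
    chiLower ε s ≤ chiUpper ε s := by
  have := threshold_nonneg hε
  have := hε.1
  have := hε.2
  unfold chiLower chiUpper
  split_ifs <;> linarith

theorem chiLower_mem {ε : ℝ} (hε : ε ∈ Icc (0 : ℝ) (1 / 5)) (s : ℝ) : chiLower ε s ∈ Icc (0 : ℝ) 1 := by
  have := hε.1
  have := hε.2
  unfold chiLower
  split_ifs <;> constructor <;> linarith

theorem chiUpper_mem {ε : ℝ} (hε : ε ∈ Icc (0 : ℝ) (1 / 5)) (s : ℝ) : chiUpper ε s ∈ Icc (0 : ℝ) 1 := by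
  have := hε.1
  have := hε.2
  unfold chiUpper
  split_ifs <;> constructor <;> linarith

theorem measurable_chiLower (ε : ℝ) : Measurable (chiLower ε) :=
  Measurable.ite measurableSet_Iic measurable_const measurable_const

theorem measurable_chiUpper (ε : ℝ) : Measurable (chiUpper ε) :=
  Measurable.ite measurableSet_Iio measurable_const measurable_const

section ChiLimit

variable {ι : Type*} {l : Filter ι} {ε s : ι → ℝ} {ε₀ s₀ : ℝ}

/-- `chiUpper` is jointly upper semicontinuous: the limit superior of `chiUpper (ε i) (s i)` is at
most `chiUpper ε₀ s₀`. Taking the maximum with the limit value turns this into a convergence. -/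
theorem tendsto_max_chiUpper (hε : ∀ i, ε i ∈ Icc (0 : ℝ) (1 / 5))
    (hε₀ : ε₀ ∈ Icc (0 : ℝ) (1 / 5)) (hεl : Tendsto ε l (𝓝 ε₀)) (hs : Tendsto s l (𝓝 s₀)) :
    Tendsto (fun i => max (chiUpper (ε i) (s i)) (chiUpper ε₀ s₀)) l (𝓝 (chiUpper ε₀ s₀)) := by
  by_cases h : s₀ < -threshold ε₀
  · have h1 : chiUpper ε₀ s₀ = ε₀ := if_pos h
    have h2 : ∀ᶠ i in l, s i < -threshold (ε i) :=
      hs.eventually_lt (tendsto_threshold (by linarith [hε₀.2]) hεl).neg h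
    rw [h1]
    have h3 : Tendsto (fun i => max (ε i) ε₀) l (𝓝 ε₀) := by
      simpa using hεl.max (tendsto_const_nhds (x := ε₀))
    refine h3.congr' ?_
    filter_upwards [h2] with i hi
    simp [chiUpper, hi]
  · have h1 : chiUpper ε₀ s₀ = 1 := if_neg h
    rw [h1]
    refine tendsto_const_nhds.congr fun i => ?_
    exact (max_eq_right (chiUpper_mem (hε i) _).2).symm

/-- `chiLower` is jointly lower semicontinuous. -/
theorem tendsto_min_chiLower (hε : ∀ i, ε i ∈ Icc (0 : ℝ) (1 / 5))
    (hε₀ : ε₀ ∈ Icc (0 : ℝ) (1 / 5)) (hεl : Tendsto ε l (𝓝 ε₀)) (hs : Tendsto s l (𝓝 s₀)) :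
    Tendsto (fun i => min (chiLower (ε i) (s i)) (chiLower ε₀ s₀)) l (𝓝 (chiLower ε₀ s₀)) := by
  by_cases h : s₀ ≤ threshold ε₀
  · have h1 : chiLower ε₀ s₀ = 0 := if_pos h
    rw [h1]
    refine tendsto_const_nhds.congr fun i => ?_
    exact (min_eq_right (chiLower_mem (hε i) _).1).symm
  · have h1 : chiLower ε₀ s₀ = 1 - ε₀ := if_neg h
    have h2 : ∀ᶠ i in l, threshold (ε i) < s i :=
      (tendsto_threshold (by linarith [hε₀.2]) hεl).eventually_lt hs (not_le.1 h)
    rw [h1]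
    have h3 : Tendsto (fun i => min (1 - ε i) (1 - ε₀)) l (𝓝 (1 - ε₀)) := by
      simpa using (hεl.const_sub 1).min (tendsto_const_nhds (x := 1 - ε₀))
    refine h3.congr' ?_
    filter_upwards [h2] with i hi
    simp [chiLower, not_le.2 hi]

end ChiLimit

/-! ### Aumann integrals of the inflated Heaviside multifunction -/

theorem exists_mem_Icc_abs_sub_le {a b w η : ℝ} (hab : a ≤ b) (hη : 0 ≤ η) (ha : a - η ≤ w)
    (hb : w ≤ b + η) : ∃ x ∈ Icc a b, |w - x| ≤ η := by
  refine ⟨max a (min w b), ⟨le_max_left _ _, max_le hab (min_le_right _ _)⟩, ?_⟩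
  grind

section Aumann

variable {μ : Measure Past} [IsFiniteMeasure μ] {ε : ℝ} {x : Past → ℝ}

theorem integrable_of_mem_unitInterval {f : Past → ℝ} (hf : Measurable f)
    (h : ∀ τ, f τ ∈ Icc (0 : ℝ) 1) : Integrable f μ :=
  Integrable.of_bound hf.aestronglyMeasurable 1 (ae_of_all _ fun τ => by
    rw [Real.norm_eq_abs, abs_of_nonneg (h τ).1]; exact (h τ).2)

theorem integrable_chiLower (hε : ε ∈ Icc (0 : ℝ) (1 / 5)) (hx : Measurable x) :
    Integrable (fun τ => chiLower ε (x τ)) μ :=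
  integrable_of_mem_unitInterval ((measurable_chiLower ε).comp hx) fun _ => chiLower_mem hε _

theorem integrable_chiUpper (hε : ε ∈ Icc (0 : ℝ) (1 / 5)) (hx : Measurable x) :
    Integrable (fun τ => chiUpper ε (x τ)) μ :=
  integrable_of_mem_unitInterval ((measurable_chiUpper ε).comp hx) fun _ => chiUpper_mem hε _

/-- The Aumann integral of an interval-valued map is the interval between the integrals of its
ends: it contains both, and is convex. -/
theorem aumannIntegral_chi (hε : ε ∈ Icc (0 : ℝ) (1 / 5)) (hx : Measurable x) :
    aumannIntegral (fun τ => chi ε (x τ)) μ =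
      Icc (∫ τ, chiLower ε (x τ) ∂μ) (∫ τ, chiUpper ε (x τ) ∂μ) := by
  have hL := integrable_chiLower (μ := μ) hε hx
  have hU := integrable_chiUpper (μ := μ) hε hx
  have hle := fun τ => chiLower_le_chiUpper hε (x τ)
  refine Subset.antisymm ?_ ?_
  · rintro _ ⟨s, hs, hsi, rfl⟩
    simp only [chi_eq_Icc hε] at hs
    exact ⟨integral_mono hL hsi fun τ => (hs τ).1, integral_mono hsi hU fun τ => (hs τ).2⟩
  · have hconv : Convex ℝ (aumannIntegral (fun τ => chi ε (x τ)) μ) := by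
      rintro _ ⟨s, hs, hsi, rfl⟩ _ ⟨s', hs', hsi', rfl⟩ a b ha hb hab
      simp only [chi_eq_Icc hε] at hs hs'
      refine ⟨fun τ => a • s τ + b • s' τ, fun τ => ?_, (hsi.smul a).add (hsi'.smul b), ?_⟩
      · simp only [chi_eq_Icc hε]
        exact convex_Icc _ _ (hs τ) (hs' τ) ha hb hab
      · simp only [smul_eq_mul]
        rw [integral_add (hsi.const_mul a) (hsi'.const_mul b), integral_const_mul,
          integral_const_mul]
    refine hconv.ordConnected.out ⟨_, fun τ => ?_, hL, rfl⟩ ⟨_, fun τ => ?_, hU, rfl⟩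
    · simp only [chi_eq_Icc hε]; exact left_mem_Icc.2 (hle τ)
    · simp only [chi_eq_Icc hε]; exact right_mem_Icc.2 (hle τ)

theorem integral_chiLower_le_integral_chiUpper (hε : ε ∈ Icc (0 : ℝ) (1 / 5))
    (hx : Measurable x) : ∫ τ, chiLower ε (x τ) ∂μ ≤ ∫ τ, chiUpper ε (x τ) ∂μ :=
  integral_mono (integrable_chiLower hε hx) (integrable_chiUpper hε hx)
    fun τ => chiLower_le_chiUpper hε (x τ)

theorem abs_le_of_mem_aumannIntegral_chi (hε : ε ∈ Icc (0 : ℝ) (1 / 5)) (hx : Measurable x)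
    {w : ℝ} (hw : w ∈ aumannIntegral (fun τ => chi ε (x τ)) μ) : |w| ≤ μ.real univ := by
  rw [aumannIntegral_chi hε hx] at hw
  have h0 : 0 ≤ ∫ τ, chiLower ε (x τ) ∂μ := integral_nonneg fun τ => (chiLower_mem hε _).1
  have h1 : ∫ τ, chiUpper ε (x τ) ∂μ ≤ ∫ _, (1 : ℝ) ∂μ :=
    integral_mono (integrable_chiUpper hε hx) (integrable_const _) fun τ => (chiUpper_mem hε _).2
  rw [integral_const, smul_eq_mul, mul_one] at h1
  rw [abs_of_nonneg (h0.trans hw.1)]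
  exact hw.2.trans h1

/-- Upper semicontinuity of the Aumann integral, from dominated convergence for the parts of
`chi (ε i)` that stick out of `chi ε₀`. -/
theorem tendstoUpper_aumannIntegral_chi {ι : Type*} {l : Filter ι} [l.IsCountablyGenerated]
    {ε : ι → ℝ} {ε₀ : ℝ} (hε : ∀ i, ε i ∈ Icc (0 : ℝ) (1 / 5)) (hε₀ : ε₀ ∈ Icc (0 : ℝ) (1 / 5))
    (hεl : Tendsto ε l (𝓝 ε₀)) {y : ι → Past → ℝ} (hy : ∀ᶠ i in l, Measurable (y i))
    (hx : Measurable x) (hyx : ∀ τ, Tendsto (fun i => y i τ) l (𝓝 (x τ))) :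
    TendstoUpper l (fun i => aumannIntegral (fun τ => chi (ε i) (y i τ)) μ)
      (aumannIntegral (fun τ => chi ε₀ (x τ)) μ) := by
  have hU : Tendsto (fun i => ∫ τ, max (chiUpper (ε i) (y i τ)) (chiUpper ε₀ (x τ)) ∂μ) l
      (𝓝 (∫ τ, chiUpper ε₀ (x τ) ∂μ)) := by
    refine tendsto_integral_filter_of_dominated_convergence (fun _ => 1) ?_ ?_
      (integrable_const _)
      (ae_of_all _ fun τ => tendsto_max_chiUpper hε hε₀ hεl (hyx τ))
    · filter_upwards [hy] with i hi
      exact (((measurable_chiUpper _).comp hi).max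
        ((measurable_chiUpper _).comp hx)).aestronglyMeasurable
    · refine Eventually.of_forall fun i => ae_of_all _ fun τ => ?_
      have h1 := chiUpper_mem (hε i) (y i τ)
      have h2 := chiUpper_mem hε₀ (x τ)
      rw [Real.norm_eq_abs, abs_of_nonneg (h1.1.trans (le_max_left _ _))]
      exact max_le h1.2 h2.2
  have hL : Tendsto (fun i => ∫ τ, min (chiLower (ε i) (y i τ)) (chiLower ε₀ (x τ)) ∂μ) l
      (𝓝 (∫ τ, chiLower ε₀ (x τ) ∂μ)) := by
    refine tendsto_integral_filter_of_dominated_convergence (fun _ => 1) ?_ ?_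
      (integrable_const _)
      (ae_of_all _ fun τ => tendsto_min_chiLower hε hε₀ hεl (hyx τ))
    · filter_upwards [hy] with i hi
      exact (((measurable_chiLower _).comp hi).min
        ((measurable_chiLower _).comp hx)).aestronglyMeasurable
    · refine Eventually.of_forall fun i => ae_of_all _ fun τ => ?_
      have h1 := chiLower_mem (hε i) (y i τ)
      have h2 := chiLower_mem hε₀ (x τ)
      rw [Real.norm_eq_abs, abs_of_nonneg (le_min h1.1 h2.1)]
      exact (min_le_left _ _).trans h1.2
  intro η hη
  filter_upwards [hy, hU.eventually (ge_mem_nhds (lt_add_of_pos_right _ hη)),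
    hL.eventually (le_mem_nhds (sub_lt_self _ hη))] with i hi hUi hLi w hw
  rw [aumannIntegral_chi (hε i) hi] at hw
  rw [aumannIntegral_chi hε₀ hx]
  have iU := integrable_chiUpper (μ := μ) (hε i) hi
  have iL := integrable_chiLower (μ := μ) (hε i) hi
  have hwU : w ≤ ∫ τ, chiUpper ε₀ (x τ) ∂μ + η :=
    (hw.2.trans (integral_mono iU (iU.sup (integrable_chiUpper hε₀ hx))
      fun τ => le_max_left _ _)).trans hUi
  have hwL : ∫ τ, chiLower ε₀ (x τ) ∂μ - η ≤ w :=
    hLi.trans ((integral_mono (iL.inf (integrable_chiLower hε₀ hx)) iL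
      fun τ => min_le_left _ _).trans hw.1)
  have hLU := integral_chiLower_le_integral_chiUpper (μ := μ) hε₀ hx
  exact exists_mem_Icc_abs_sub_le hLU hη.le hwL hwU

end Aumann

/-! ### The inclusion in coordinates -/

/-- The coordinates of a state, over a single index set. -/
def coord {n : ℕ} (c : Fin n ⊕ OffDiag n) (x : State n) : ℝ := Sum.elim x.1 x.2 c

section Coord

variable {n : ℕ}

theorem norm_le_iff_coord {x : State n} {R : ℝ} (hR : 0 ≤ R) :
    ‖x‖ ≤ R ↔ ∀ c, |coord c x| ≤ R := by
  rw [Prod.norm_def, max_le_iff, pi_norm_le_iff_of_nonneg hR, pi_norm_le_iff_of_nonneg hR,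
    Sum.forall]
  rfl

theorem abs_coord_le (c : Fin n ⊕ OffDiag n) (x : State n) : |coord c x| ≤ ‖x‖ :=
  (norm_le_iff_coord (norm_nonneg x)).1 le_rfl c

theorem coord_sub (c : Fin n ⊕ OffDiag n) (x y : State n) :
    coord c (x - y) = coord c x - coord c y := by
  cases c <;> rfl

theorem lipschitzWith_coord (c : Fin n ⊕ OffDiag n) :
    LipschitzWith 1 (coord c : State n → ℝ) :=
  LipschitzWith.of_dist_le_mul fun x y => by
    rw [Real.dist_eq, ← coord_sub, NNReal.coe_one, one_mul, dist_eq_norm]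
    exact abs_coord_le c _

theorem hasDerivAt_iff_coord {u : ℝ → State n} {v : State n} {t : ℝ} :
    HasDerivAt u v t ↔ ∀ c, HasDerivAt (fun s => coord c (u s)) (coord c v) t := by
  have hprod : HasDerivAt u v t ↔
      HasDerivAt (fun s => (u s).1) v.1 t ∧ HasDerivAt (fun s => (u s).2) v.2 t :=
    ⟨fun h => ⟨h.fst, h.snd⟩, fun h => h.1.prodMk h.2⟩
  rw [hprod, hasDerivAt_pi, hasDerivAt_pi, Sum.forall]
  rfl

end Coord

namespace Network

variable {n : ℕ} (N : Network n)

/-- The decay rates `A_i` and `B_ij`, over a single index set. -/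
def rate (c : Fin n ⊕ OffDiag n) : ℝ → ℝ := Sum.elim N.A N.B c

/-- The factors of the product `N.inflatedTerm ε u`. -/
def gain (ε : ℝ) (u : Past → State n) (c : Fin n ⊕ OffDiag n) : Set ℝ :=
  Sum.elim
    (fun i => ∑ k : {k : Fin n // k ≠ i},
      ((u now).2 ⟨(k, i), k.2⟩ - N.c ⟨(k, i), k.2⟩) • N.signal ε u ⟨(k, i), k.2⟩)
    (fun p => (N.d p * max ((u now).1 p.1.2) 0) • N.signal ε u p) c

/-- The coordinates of the right-hand side `D(u) + X^ε(u) + I(t)` of the inclusion. -/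
def rhs (ε t : ℝ) (u : Past → State n) (c : Fin n ⊕ OffDiag n) : Set ℝ :=
  {-N.rate c (coord c (u now)) * coord c (u now)} + N.gain ε u c + {coord c (N.stimuli t)}

/-- The right-hand side of the inclusion is a product of subsets of `ℝ`. -/
theorem mem_rhs_iff {ε t : ℝ} {u : Past → State n} {v : State n} :
    v ∈ {N.decay u} + N.inflatedTerm ε u + {N.stimuli t} ↔ ∀ c, coord c v ∈ N.rhs ε t u c := by
  have h1 : v ∈ {N.decay u} + N.inflatedTerm ε u + {N.stimuli t} ↔
      v - N.decay u - N.stimuli t ∈ N.inflatedTerm ε u := by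
    simp only [Set.mem_add, Set.mem_singleton_iff]
    constructor
    · rintro ⟨_, ⟨_, rfl, x, hx, rfl⟩, _, rfl, rfl⟩
      convert hx using 1
      abel
    · intro h
      exact ⟨_, ⟨_, rfl, _, h, rfl⟩, _, rfl, by abel⟩
  have h2 : ∀ (a b x : ℝ) (S : Set ℝ), x ∈ {a} + S + {b} ↔ x - a - b ∈ S := by
    intro a b x S
    simp only [Set.mem_add, Set.mem_singleton_iff]
    constructor
    · rintro ⟨_, ⟨_, rfl, x, hx, rfl⟩, _, rfl, rfl⟩
      convert hx using 1
      ring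
    · intro h
      exact ⟨_, ⟨_, rfl, _, h, rfl⟩, _, rfl, by ring⟩
  rw [h1, inflatedTerm, Set.mem_prod, Set.mem_univ_pi, Set.mem_univ_pi, Sum.forall]
  simp only [rhs, h2]
  rfl

variable {N}

theorem HypM.isFiniteMeasure {γ : ℝ} (hγ : 0 < γ) (hM : N.HypM γ) (p : OffDiag n) :
    IsFiniteMeasure (N.μ p) := by
  refine ⟨lt_of_le_of_lt ?_ (hM p)⟩
  rw [← lintegral_one]
  refine lintegral_mono fun τ => ?_
  rw [← ENNReal.ofReal_one]
  refine ENNReal.ofReal_le_ofReal (Real.one_le_exp ?_)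
  have : (τ : ℝ) ≤ 0 := τ.2
  nlinarith

section Signal

variable {u : Past → State n} {ε : ℝ}

theorem measurable_signal_arg (hu : Continuous u) (p : OffDiag n) :
    Measurable fun τ => (u τ).1 p.1.1 - N.Γ p.1.1 := by
  have h1 : Continuous fun τ => (u τ).1 p.1.1 := (continuous_apply _).comp hu.fst
  exact (h1.sub continuous_const).measurable

theorem signal_eq_Icc (hfin : ∀ p, IsFiniteMeasure (N.μ p)) (hε : ε ∈ Icc (0 : ℝ) (1 / 5))
    (hu : Continuous u) (p : OffDiag n) :
    ∃ a b : ℝ, a ≤ b ∧ N.signal ε u p = Icc a b :=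
  have := hfin p
  ⟨_, _, integral_chiLower_le_integral_chiUpper hε (measurable_signal_arg hu p),
    aumannIntegral_chi hε (measurable_signal_arg hu p)⟩

/-- The factors of `X^ε` are compact intervals. -/
theorem gain_compact_convex (hfin : ∀ p, IsFiniteMeasure (N.μ p))
    (hε : ε ∈ Icc (0 : ℝ) (1 / 5)) (hu : Continuous u) (c : Fin n ⊕ OffDiag n) :
    IsCompact (N.gain ε u c) ∧ Convex ℝ (N.gain ε u c) ∧ (N.gain ε u c).Nonempty := by
  have key : ∀ (a : ℝ) (p : OffDiag n), IsCompact (a • N.signal ε u p) ∧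
      Convex ℝ (a • N.signal ε u p) ∧ (a • N.signal ε u p).Nonempty := by
    intro a p
    obtain ⟨x, y, hxy, h⟩ := signal_eq_Icc hfin hε hu p
    rw [h]
    exact ⟨isCompact_Icc.smul a, (convex_Icc x y).smul a, (nonempty_Icc.2 hxy).smul_set⟩
  cases c with
  | inl i =>
    refine ⟨?_, ?_, ?_⟩
    · simp only [gain, Sum.elim_inl]
      refine Finset.sum_induction _ IsCompact (fun _ _ h h' => h.add h') ?_
        fun k _ => (key _ _).1
      exact isCompact_singleton
    · simp only [gain, Sum.elim_inl]
      exact convex_sum _ fun k _ => (key _ _).2.1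
    · simp only [gain, Sum.elim_inl]
      refine Finset.sum_induction _ Set.Nonempty (fun _ _ h h' => h.add h') ?_
        fun k _ => (key _ _).2.2
      exact Set.singleton_nonempty _
  | inr p => exact key _ p

theorem rhs_compact_convex (hfin : ∀ p, IsFiniteMeasure (N.μ p))
    (hε : ε ∈ Icc (0 : ℝ) (1 / 5)) (hu : Continuous u) (t : ℝ) (c : Fin n ⊕ OffDiag n) :
    IsCompact (N.rhs ε t u c) ∧ Convex ℝ (N.rhs ε t u c) ∧ (N.rhs ε t u c).Nonempty := by
  obtain ⟨h1, h2, h3⟩ := gain_compact_convex hfin hε hu c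
  exact ⟨(isCompact_singleton.add h1).add isCompact_singleton,
    ((convex_singleton _).add h2).add (convex_singleton _),
    ((singleton_nonempty _).add h3).add (singleton_nonempty _)⟩

/-- The excitation and inhibition term grows at most linearly in the current state. -/
theorem exists_gain_bound (hfin : ∀ p, IsFiniteMeasure (N.μ p)) :
    ∃ K : ℝ, 0 ≤ K ∧ ∀ (ε : ℝ) (u : Past → State n), ε ∈ Icc (0 : ℝ) (1 / 5) → Continuous u →
      ∀ c, ∀ v ∈ N.gain ε u c, |v| ≤ K * (1 + ‖u now‖) := by
  set M : ℝ := ∑ p, (1 + N.c p + N.d p) * (N.μ p).real univ with hMdef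
  have hterm : ∀ p, 0 ≤ (1 + N.c p + N.d p) * (N.μ p).real univ := fun p =>
    mul_nonneg (by linarith [N.c_nonneg p, N.d_nonneg p]) measureReal_nonneg
  have hM0 : 0 ≤ M := Finset.sum_nonneg fun p _ => hterm p
  have hMp : ∀ p, (1 + N.c p + N.d p) * (N.μ p).real univ ≤ M := fun p =>
    Finset.single_le_sum (fun q _ => hterm q) (Finset.mem_univ p)
  have key : ∀ (ε : ℝ) (u : Past → State n), ε ∈ Icc (0 : ℝ) (1 / 5) → Continuous u →
      ∀ (p : OffDiag n) (a : ℝ), |a| ≤ (1 + N.c p + N.d p) * (1 + ‖u now‖) →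
      ∀ v ∈ a • N.signal ε u p, |v| ≤ M * (1 + ‖u now‖) := by
    intro ε u hε hu p a ha v hv
    obtain ⟨w, hw, rfl⟩ := Set.mem_smul_set.1 hv
    have := hfin p
    have hw' : |w| ≤ (N.μ p).real univ :=
      abs_le_of_mem_aumannIntegral_chi hε (measurable_signal_arg hu p) hw
    rw [smul_eq_mul, abs_mul]
    calc |a| * |w| ≤ ((1 + N.c p + N.d p) * (1 + ‖u now‖)) * (N.μ p).real univ :=
          mul_le_mul ha hw' (abs_nonneg _) ((abs_nonneg _).trans ha)
      _ = ((1 + N.c p + N.d p) * (N.μ p).real univ) * (1 + ‖u now‖) := by ring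
      _ ≤ M * (1 + ‖u now‖) := by gcongr; exact hMp p
  refine ⟨(n + 1) * M, by positivity, fun ε u hε hu c v hv => ?_⟩
  have hR := norm_nonneg (u now)
  have hMR : 0 ≤ M * (1 + ‖u now‖) := by positivity
  cases c with
  | inl i =>
    simp only [gain, Sum.elim_inl] at hv
    obtain ⟨g, hg, rfl⟩ := (Set.mem_finsetSum _ _ _).1 hv
    have hgk : ∀ k ∈ Finset.univ, |g k| ≤ M * (1 + ‖u now‖) := by
      intro k hk
      refine key ε u hε hu _ _ ?_ _ (hg hk)
      have h1 : |coord (Sum.inr ⟨(k, i), k.2⟩) (u now)| ≤ ‖u now‖ := abs_coord_le _ _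
      change |(u now).2 ⟨(k, i), k.2⟩| ≤ ‖u now‖ at h1
      have h2 := N.c_nonneg ⟨(k, i), k.2⟩
      have h3 := N.d_nonneg ⟨(k, i), k.2⟩
      have h4 := abs_sub ((u now).2 ⟨(k, i), k.2⟩) (N.c ⟨(k, i), k.2⟩)
      rw [abs_of_nonneg h2] at h4
      nlinarith [mul_nonneg h2 hR, mul_nonneg h3 hR]
    have hcard : (Fintype.card {k : Fin n // k ≠ i} : ℝ) ≤ n := by
      have := Fintype.card_subtype_le fun k : Fin n => k ≠ i
      rw [Fintype.card_fin] at this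
      exact_mod_cast this
    calc |∑ k, g k| ≤ ∑ k, |g k| := Finset.abs_sum_le_sum_abs _ _
      _ ≤ ∑ _k : {k : Fin n // k ≠ i}, M * (1 + ‖u now‖) := Finset.sum_le_sum hgk
      _ = (Fintype.card {k : Fin n // k ≠ i} : ℝ) * (M * (1 + ‖u now‖)) := by
        rw [Finset.sum_const, nsmul_eq_mul, Finset.card_univ]
      _ ≤ (n + 1) * (M * (1 + ‖u now‖)) := by gcongr; linarith
      _ = (n + 1) * M * (1 + ‖u now‖) := by ring
  | inr p =>
    have h1 : |(u now).1 p.1.2| ≤ ‖u now‖ := abs_coord_le (Sum.inl p.1.2) (u now)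
    have h2 := N.c_nonneg p
    have h3 := N.d_nonneg p
    have := key ε u hε hu p (N.d p * max ((u now).1 p.1.2) 0) (by
      rw [abs_mul, abs_of_nonneg h3, abs_of_nonneg (le_max_right _ _)]
      have h4 : max ((u now).1 p.1.2) 0 ≤ ‖u now‖ := max_le ((le_abs_self _).trans h1) hR
      have h5 := mul_le_mul_of_nonneg_left h4 h3
      nlinarith [mul_nonneg h2 hR]) v hv
    have hn : (0 : ℝ) ≤ n := Nat.cast_nonneg n
    nlinarith

/-- Joint upper semicontinuity of the right-hand side in the inflation parameter, the time and
the history, the histories converging pointwise only. -/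
theorem tendstoUpper_rhs (hD : N.HypD) (hI : N.HypI) (hfin : ∀ p, IsFiniteMeasure (N.μ p))
    {ι : Type*} {l : Filter ι} [l.IsCountablyGenerated] {ε : ι → ℝ} {ε₀ : ℝ}
    (hε : ∀ i, ε i ∈ Icc (0 : ℝ) (1 / 5)) (hε₀ : ε₀ ∈ Icc (0 : ℝ) (1 / 5))
    (hεl : Tendsto ε l (𝓝 ε₀)) {t : ι → ℝ} {t₀ : ℝ} (ht : Tendsto t l (𝓝 t₀))
    {w : ι → Past → State n} (hw : ∀ᶠ i in l, Continuous (w i)) (hu : Continuous u)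
    (hwu : ∀ τ, Tendsto (fun i => w i τ) l (𝓝 (u τ))) (c : Fin n ⊕ OffDiag n) :
    TendstoUpper l (fun i => N.rhs (ε i) (t i) (w i) c) (N.rhs ε₀ t₀ u c) := by
  have hrate : Continuous (N.rate c) := by
    cases c with
    | inl i => exact (hD.1 i).continuous
    | inr p => exact (hD.2.1 p).continuous
  have hc : Tendsto (fun i => coord c (w i now)) l (𝓝 (coord c (u now))) :=
    ((lipschitzWith_coord c).continuous.tendsto _).comp (hwu now)
  have hstim : Tendsto (fun i => coord c (N.stimuli (t i))) l (𝓝 (coord c (N.stimuli t₀))) := by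
    cases c with
    | inl i => exact ((hI i).tendsto t₀).comp ht
    | inr p => exact tendsto_const_nhds
  have h1 : ∀ j, Tendsto (fun i => (w i now).1 j) l (𝓝 ((u now).1 j)) := fun j =>
    ((lipschitzWith_coord (Sum.inl j)).continuous.tendsto _).comp (hwu now)
  have h2 : ∀ p, Tendsto (fun i => (w i now).2 p) l (𝓝 ((u now).2 p)) := fun p =>
    ((lipschitzWith_coord (Sum.inr p)).continuous.tendsto _).comp (hwu now)
  have hsig : ∀ p, TendstoUpper l (fun i => N.signal (ε i) (w i) p) (N.signal ε₀ u p) := by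
    intro p
    have := hfin p
    refine tendstoUpper_aumannIntegral_chi hε hε₀ hεl ?_ (measurable_signal_arg hu p) ?_
    · filter_upwards [hw] with i hi using measurable_signal_arg hi p
    · intro τ
      exact (((lipschitzWith_coord (Sum.inl p.1.1)).continuous.tendsto _).comp (hwu τ)).sub_const _
  have hbdd : ∀ p, Bornology.IsBounded (N.signal ε₀ u p) := by
    intro p
    obtain ⟨a, b, -, h⟩ := signal_eq_Icc hfin hε₀ hu p
    rw [h]
    exact Metric.isBounded_Icc a b
  have hgain : TendstoUpper l (fun i => N.gain (ε i) (w i) c) (N.gain ε₀ u c) := by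
    cases c with
    | inl i => 
      simp only [gain, Sum.elim_inl]
      exact TendstoUpper.sum fun k _ =>
        TendstoUpper.smul ((h2 _).sub_const _) (hsig _) (hbdd _)
    | inr p =>
      exact TendstoUpper.smul (((h1 _).max tendsto_const_nhds).const_mul _) (hsig p) (hbdd p)
  exact ((TendstoUpper.singleton (((hrate.tendsto _).comp hc).neg.mul hc)).add hgain).add
    (TendstoUpper.singleton hstim)

end Signal

end Network

/-! ### Histories and convergence -/

theorem history_now {E : Type*} (u : ℝ → E) (t : ℝ) : history u t now = u t := by
  simp [history, now]

theorem continuousOn_Iic_of_history {E : Type*} [TopologicalSpace E] {u : ℝ → E} {t₀ t₁ : ℝ}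
    (hh : Continuous (history u t₀)) (hc : ContinuousOn u (Icc t₀ t₁)) :
    ContinuousOn u (Iic t₁) := by
  have h1 : ContinuousOn u (Iic t₀) := by
    rw [continuousOn_iff_continuous_domRestrict]
    have hs : Continuous fun s : Iic t₀ => (⟨s - t₀, mem_Iic.2 (sub_nonpos.2 s.2)⟩ : Past) := by fun_prop
    refine (hh.comp hs).congr fun s => ?_
    simp [history]
  refine (h1.union_of_isClosed hc isClosed_Iic isClosed_Icc).mono fun s hs => ?_
  rcases le_total s t₀ with h | h
  · exact Or.inl h
  · exact Or.inr ⟨h, hs⟩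

theorem continuous_history {E : Type*} [TopologicalSpace E] {u : ℝ → E} {t t₁ : ℝ}
    (hc : ContinuousOn u (Iic t₁)) (ht : t ≤ t₁) : Continuous (history u t) := by
  refine hc.comp_continuous (by fun_prop) fun s => ?_
  have : (s : ℝ) ≤ 0 := s.2
  rw [Set.mem_Iic]
  linarith

theorem norm_apply_le_gammaNorm {γ : ℝ} {E : Type*} [NormedAddCommGroup E] [NormedSpace ℝ E]
    (ψ : CGamma γ E) (s : Past) :
    ‖(ψ : Past → E) s‖ ≤ Real.exp (-(γ * s)) * gammaNorm ψ := by
  have h := le_ciSup (bddAbove_gammaNorm ψ) s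
  have h2 := mul_le_mul_of_nonneg_left h (Real.exp_pos (-(γ * s))).le
  rwa [← mul_assoc, ← Real.exp_add, neg_add_cancel, Real.exp_zero, one_mul] at h2

/-- Convergence of the initial data in `C_γ` and uniform convergence on `[t₀, t₁]` give uniform
convergence on every compact interval of the past. -/
theorem tendstoUniformlyOn_Icc_of_history {γ : ℝ} (hγ : 0 < γ) {E : Type*}
    [NormedAddCommGroup E] [NormedSpace ℝ E] {v : ℕ → ℝ → E} {w : ℝ → E} {t₀ t₁ : ℝ}
    {ψ : ℕ → CGamma γ E} {ψ₀ : CGamma γ E} (hv : ∀ m, history (v m) t₀ = ψ m)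
    (hw : history w t₀ = ψ₀) (hψ : Tendsto (fun m => gammaNorm (ψ m - ψ₀)) atTop (𝓝 0))
    (hu : TendstoUniformlyOn v w atTop (Icc t₀ t₁)) (a : ℝ) :
    TendstoUniformlyOn v w atTop (Icc a t₁) := by
  rw [Metric.tendstoUniformlyOn_iff] at hu ⊢
  intro η hη
  have h0 : Tendsto (fun m => Real.exp (γ * (t₀ - a)) * gammaNorm (ψ m - ψ₀)) atTop (𝓝 0) := by
    simpa using hψ.const_mul (Real.exp (γ * (t₀ - a)))
  filter_upwards [hu η hη, h0.eventually (gt_mem_nhds hη)] with m h1 h2 s hs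
  rcases le_total t₀ s with h | h
  · exact h1 s ⟨h, hs.2⟩
  · have hτ : s - t₀ ≤ 0 := sub_nonpos.2 h
    have e1 : v m s = (ψ m : Past → E) ⟨s - t₀, hτ⟩ := by
      rw [← hv m]; simp [history]
    have e2 : w s = (ψ₀ : Past → E) ⟨s - t₀, hτ⟩ := by
      rw [← hw]; simp [history]
    have h3 := norm_apply_le_gammaNorm (ψ m - ψ₀) ⟨s - t₀, hτ⟩
    have h4 : 0 ≤ gammaNorm (ψ m - ψ₀) :=
      Real.iSup_nonneg fun s => mul_nonneg (Real.exp_pos _).le (norm_nonneg _)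
    have h5 : Real.exp (-(γ * (s - t₀))) ≤ Real.exp (γ * (t₀ - a)) :=
      Real.exp_le_exp.2 (by nlinarith [hs.1])
    rw [dist_comm, dist_eq_norm, e1, e2]
    exact (h3.trans (mul_le_mul_of_nonneg_right h5 h4)).trans_lt h2

/-- The Arzelà–Ascoli theorem for uniformly Lipschitz sequences on a compact interval. -/
theorem exists_subseq_tendstoUniformlyOn_of_lipschitz {E : Type*} [NormedAddCommGroup E]
    [ProperSpace E] {v : ℕ → ℝ → E} {a b R : ℝ} {L : NNReal} (hab : a ≤ b)
    (hR : ∀ m, ∀ t ∈ Icc a b, ‖v m t‖ ≤ R) (hL : ∀ m, LipschitzOnWith L (v m) (Icc a b)) :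
    ∃ (k : ℕ → ℕ) (g : ℝ → E), StrictMono k ∧ LipschitzOnWith L g (Icc a b) ∧
      TendstoUniformlyOn (fun l => v (k l)) g atTop (Icc a b) := by
  let F : ℕ → BoundedContinuousFunction (Icc a b) E := fun m =>
    BoundedContinuousFunction.mkOfCompact ⟨(Icc a b).domRestrict (v m), (hL m).continuousOn.domRestrict⟩
  have hcomp : IsCompact (closure (range F)) := by
    refine BoundedContinuousFunction.arzela_ascoli (Metric.closedBall 0 R)
      (isCompact_closedBall 0 R) _ ?_ ?_
    · rintro _ x ⟨m, rfl⟩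
      exact mem_closedBall_zero_iff.2 (hR m x x.2)
    · refine Metric.equicontinuous_of_continuity_modulus (fun s => L * s) ?_ _ ?_
      · simpa using (tendsto_id (x := 𝓝 (0 : ℝ))).const_mul (L : ℝ)
      · rintro x y ⟨_, m, rfl⟩
        exact (hL m).dist_le_mul x x.2 y y.2
  obtain ⟨G, -, k, hk, hG⟩ := hcomp.tendsto_subseq fun m => subset_closure (mem_range_self m)
  have hunif : TendstoUniformlyOn (fun l => v (k l)) (fun t => G (projIcc a b hab t)) atTop
      (Icc a b) := by
    rw [tendstoUniformlyOn_iff_tendstoUniformly_comp_coe]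
    have h1 := BoundedContinuousFunction.tendsto_iff_tendstoUniformly.1 hG
    have h2 : (fun t => G (projIcc a b hab t)) ∘ ((↑) : Icc a b → ℝ) = G := by
      ext t
      simp
    rw [h2]
    exact h1
  refine ⟨k, _, hk, LipschitzOnWith.of_dist_le_mul fun x hx y hy => ?_, hunif⟩
  exact le_of_tendsto ((hunif.tendsto_at hx).dist (hunif.tendsto_at hy))
    (Eventually.of_forall fun l => (hL (k l)).dist_le_mul x hx y hy)

namespace Network

variable {n : ℕ} {N : Network n} {ε t₀ T : ℝ} {φ : Past → State n} {u : ℝ → State n}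

/-! ### Estimates for solutions -/

namespace IsSolution

theorem continuousOn (h : N.IsSolution ε t₀ T φ u) (hT : 0 < T) (hφ : Continuous φ) :
    ContinuousOn u (Iic (t₀ + T)) := by
  refine continuousOn_Iic_of_history (t₀ := t₀) (by rwa [h.1]) ?_
  have := h.2.1.continuousOn
  rwa [uIcc_of_le (by linarith)] at this

theorem absolutelyContinuous_coord (h : N.IsSolution ε t₀ T φ u) (c : Fin n ⊕ OffDiag n) :
    AbsolutelyContinuousOnInterval (fun t => coord c (u t)) t₀ (t₀ + T) :=
  (lipschitzWith_coord c).comp_absolutelyContinuousOnInterval h.2.1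

theorem ae_coord (h : N.IsSolution ε t₀ T φ u) :
    ∀ᵐ t, t ∈ Icc t₀ (t₀ + T) → ∀ c, ∃ w ∈ N.rhs ε t (history u t) c,
      HasDerivAt (fun t => coord c (u t)) w t := by
  have := (ae_restrict_iff' measurableSet_Icc).1 h.2.2
  filter_upwards [this] with t ht hmem c
  obtain ⟨v, hv, hd⟩ := ht hmem
  exact ⟨coord c v, N.mem_rhs_iff.1 hv c, hasDerivAt_iff_coord.1 hd c⟩

end IsSolution

theorem HypI.exists_stimuli_bound (hI : N.HypI) (a b : ℝ) :
    ∃ C : ℝ, 0 ≤ C ∧ ∀ t ∈ Icc a b, ∀ c, |coord c (N.stimuli t)| ≤ C := by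
  have hcont : Continuous N.stimuli := by
    unfold stimuli
    exact (continuous_pi hI).prodMk continuous_const
  obtain ⟨C, hC⟩ := isCompact_Icc.exists_bound_of_continuousOn (hcont.continuousOn (s := Icc a b))
  exact ⟨max C 0, le_max_right _ _, fun t ht c =>
    ((abs_coord_le c _).trans (hC t ht)).trans (le_max_left _ _)⟩

theorem HypD.exists_rate_bound (hD : N.HypD) (R : ℝ) :
    ∃ C : ℝ, 0 ≤ C ∧ ∀ c, ∀ s, |s| ≤ R → |N.rate c s| ≤ C := by
  have hrate : ∀ c, Continuous (N.rate c) := by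
    rintro (i | p)
    · exact (hD.1 i).continuous
    · exact (hD.2.1 p).continuous
  obtain ⟨C, hC⟩ := isCompact_Icc.exists_bound_of_continuousOn
    ((continuous_pi hrate : Continuous fun s c => N.rate c s).comp_continuousOn
      (continuousOn_id (s := Icc (-R) R)))
  exact ⟨max C 0, le_max_right _ _, fun c s hs =>
    ((norm_le_pi_norm (fun c => N.rate c s) c).trans (hC s (abs_le.1 hs))).trans
      (le_max_left _ _)⟩

theorem HypD.rate_nonneg (hD : N.HypD) (c : Fin n ⊕ OffDiag n) (s : ℝ) : 0 ≤ N.rate c s := by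
  obtain ⟨α, hα, hA, hB⟩ := hD.2.2
  rcases c with i | p
  · exact hα.le.trans (hA i s)
  · exact hα.le.trans (hB p s)

/-- A priori bound: the functional `V = 1 + ∑ y_c²`, over the coordinates `y_c` of the solution,
satisfies `V' ≤ K V`, since decay is dissipative and the remaining terms grow at most
linearly. -/
theorem exists_solution_bound (hD : N.HypD) (hI : N.HypI)
    (hfin : ∀ p, IsFiniteMeasure (N.μ p)) (t₀ r : ℝ) (hT : 0 < T) :
    ∃ R : ℝ, ∀ (ε : ℝ) (φ : Past → State n) (u : ℝ → State n), ε ∈ Icc (0 : ℝ) (1 / 5) →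
      Continuous φ → ‖φ now‖ ≤ r → N.IsSolution ε t₀ T φ u →
      ∀ t ∈ Icc t₀ (t₀ + T), ‖u t‖ ≤ R := by
  obtain ⟨K, hK0, hK⟩ := exists_gain_bound hfin
  obtain ⟨C, hC0, hC⟩ := hI.exists_stimuli_bound t₀ (t₀ + T)
  set d : ℝ := (Fintype.card (Fin n ⊕ OffDiag n) : ℝ) with hd
  have hd0 : 0 ≤ d := Nat.cast_nonneg _
  set κ : ℝ := d * (4 * (K + C)) with hκ
  refine ⟨(1 + d * r ^ 2) * Real.exp (κ * T), fun ε φ u hε hφ hr hu t ht => ?_⟩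
  have hcont := hu.continuousOn hT hφ
  set V : ℝ → ℝ := fun t => 1 + ∑ c, coord c (u t) * coord c (u t) with hV
  have hnorm : ∀ s, 1 + ‖u s‖ ^ 2 ≤ V s := by
    intro s
    have h0 : 0 ≤ ∑ c, coord c (u s) * coord c (u s) :=
      Finset.sum_nonneg fun c _ => mul_self_nonneg _
    have h1 : ‖u s‖ ≤ √(∑ c, coord c (u s) * coord c (u s)) := by
      refine (norm_le_iff_coord (Real.sqrt_nonneg _)).2 fun c => Real.abs_le_sqrt ?_
      rw [pow_two]
      exact Finset.single_le_sum (f := fun c => coord c (u s) * coord c (u s))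
        (fun c _ => mul_self_nonneg _) (Finset.mem_univ c)
    have h2 := pow_le_pow_left₀ (norm_nonneg _) h1 2
    rw [Real.sq_sqrt h0] at h2
    linarith
  have hVac : AbsolutelyContinuousOnInterval V t₀ (t₀ + T) :=
    (((LipschitzWith.const (1 : ℝ)).lipschitzOnWith).absolutelyContinuousOnInterval).fun_add
      (absolutelyContinuousOnInterval_sum fun c _ =>
        (hu.absolutelyContinuous_coord c).fun_mul (hu.absolutelyContinuous_coord c))
  have hderiv : ∀ᵐ s, s ∈ Icc t₀ (t₀ + T) → ∃ v ≤ κ * V s, HasDerivAt V v s := by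
    filter_upwards [hu.ae_coord] with s hs hmem
    choose w hw hwd using hs hmem
    refine ⟨∑ c, (w c * coord c (u s) + coord c (u s) * w c), ?_, ?_⟩
    · have hterm : ∀ c, w c * coord c (u s) + coord c (u s) * w c ≤ 4 * (K + C) * V s := by
        intro c
        obtain ⟨x, hx, y, hy, hxy⟩ := Set.mem_add.1 (hw c)
        obtain ⟨z, hz, g, hg, hzg⟩ := Set.mem_add.1 hx
        rw [mem_singleton_iff, history_now] at hz
        rw [mem_singleton_iff] at hy
        have hg' := hK ε _ hε (continuous_history hcont hmem.2) c g hg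
        rw [history_now] at hg'
        have hy' : |y| ≤ C := by rw [hy]; exact hC s hmem c
        have hq := abs_coord_le c (u s)
        have hn := norm_nonneg (u s)
        have hw' : w c = -N.rate c (coord c (u s)) * coord c (u s) + g + y := by
          rw [← hxy, ← hzg, hz]
        have hdec : 0 ≤ N.rate c (coord c (u s)) * (coord c (u s) * coord c (u s)) :=
          mul_nonneg (hD.rate_nonneg _ _) (mul_self_nonneg _)
        have hgy : coord c (u s) * (g + y) ≤ ‖u s‖ * (K * (1 + ‖u s‖) + C) := by
          refine (le_abs_self _).trans ?_
          rw [abs_mul]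
          exact mul_le_mul hq ((abs_add_le _ _).trans (add_le_add hg' hy')) (abs_nonneg _) hn
        have hb : ‖u s‖ * (K * (1 + ‖u s‖) + C) ≤ 2 * (K + C) * (1 + ‖u s‖ ^ 2) := by
          nlinarith [mul_nonneg hK0 (sq_nonneg (‖u s‖ - 1)), mul_nonneg hC0 (sq_nonneg (‖u s‖ - 1)),
            mul_nonneg hK0 (sq_nonneg ‖u s‖), mul_nonneg hC0 (sq_nonneg ‖u s‖)]
        have hb' := mul_le_mul_of_nonneg_left (hnorm s) (show 0 ≤ 2 * (K + C) by positivity)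
        rw [hw']
        nlinarith
      calc ∑ c, (w c * coord c (u s) + coord c (u s) * w c)
          ≤ ∑ _c : Fin n ⊕ OffDiag n, 4 * (K + C) * V s := Finset.sum_le_sum fun c _ => hterm c
        _ = κ * V s := by
          rw [Finset.sum_const, nsmul_eq_mul, Finset.card_univ, hκ, hd]; ring
    · exact (HasDerivAt.fun_sum fun c _ => (hwd c).mul (hwd c)).const_add 1
  have hV0 : V t₀ ≤ 1 + d * r ^ 2 := by
    have h0 : u t₀ = φ now := by rw [← hu.1, history_now]
    have : ∀ c, coord c (u t₀) * coord c (u t₀) ≤ r ^ 2 := fun c => by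
      rw [← pow_two, ← sq_abs, h0]
      exact pow_le_pow_left₀ (abs_nonneg _) ((abs_coord_le c _).trans hr) 2
    have := Finset.sum_le_sum fun c (_ : c ∈ Finset.univ) => this c
    rw [Finset.sum_const, nsmul_eq_mul, Finset.card_univ] at this
    simp only [hV]
    linarith
  have hgr := le_mul_exp_of_ae_hasDerivAt_le (K := κ) ht.1
    (hVac.mono (by
      rw [uIcc_of_le ht.1, uIcc_of_le (by linarith)]
      exact Icc_subset_Icc_right ht.2))
    (by
      filter_upwards [hderiv] with s hs hmem
      exact hs ⟨hmem.1, hmem.2.trans ht.2⟩)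
  have hκ0 : 0 ≤ κ := by positivity
  have hexp : Real.exp (κ * (t - t₀)) ≤ Real.exp (κ * T) :=
    Real.exp_le_exp.2 (mul_le_mul_of_nonneg_left (by linarith [ht.2]) hκ0)
  calc ‖u t‖ ≤ 1 + ‖u t‖ ^ 2 := by nlinarith [sq_nonneg (‖u t‖ - 1)]
    _ ≤ V t := hnorm t
    _ ≤ V t₀ * Real.exp (κ * (t - t₀)) := hgr
    _ ≤ (1 + d * r ^ 2) * Real.exp (κ * T) :=
      mul_le_mul hV0 hexp (Real.exp_pos _).le (by positivity)

/-- Bounded solutions are uniformly Lipschitz. -/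
theorem exists_solution_lipschitz (hD : N.HypD) (hI : N.HypI)
    (hfin : ∀ p, IsFiniteMeasure (N.μ p)) (t₀ R : ℝ) (hT : 0 < T) :
    ∃ L : NNReal, ∀ (ε : ℝ) (φ : Past → State n) (u : ℝ → State n), ε ∈ Icc (0 : ℝ) (1 / 5) →
      Continuous φ → N.IsSolution ε t₀ T φ u → (∀ t ∈ Icc t₀ (t₀ + T), ‖u t‖ ≤ R) →
      LipschitzOnWith L u (Icc t₀ (t₀ + T)) := by
  obtain ⟨K, hK0, hK⟩ := exists_gain_bound hfin
  obtain ⟨C, hC0, hC⟩ := hI.exists_stimuli_bound t₀ (t₀ + T)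
  obtain ⟨A, hA0, hA⟩ := hD.exists_rate_bound R
  refine ⟨(A * R + K * (1 + R) + C).toNNReal, fun ε φ u hε hφ hu hR => ?_⟩
  have hcont := hu.continuousOn hT hφ
  have hR0 : 0 ≤ R := (norm_nonneg _).trans (hR t₀ ⟨le_rfl, by linarith⟩)
  have hL0 : 0 ≤ A * R + K * (1 + R) + C := by positivity
  have key : ∀ s ∈ Icc t₀ (t₀ + T), ∀ t ∈ Icc t₀ (t₀ + T), s ≤ t →
      ‖u t - u s‖ ≤ (A * R + K * (1 + R) + C) * (t - s) := by
    intro s hs t ht hst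
    refine (norm_le_iff_coord (mul_nonneg hL0 (sub_nonneg.2 hst))).2 fun c => ?_
    rw [coord_sub]
    refine abs_sub_le_of_ae_hasDerivAt hst ((hu.absolutelyContinuous_coord c).mono ?_) ?_
    · rw [uIcc_of_le hst, uIcc_of_le (by linarith)]
      exact Icc_subset_Icc hs.1 ht.2
    · filter_upwards [hu.ae_coord] with x hx hmem
      have hxI : x ∈ Icc t₀ (t₀ + T) := ⟨hs.1.trans hmem.1, hmem.2.trans ht.2⟩
      obtain ⟨w, hw, hwd⟩ := hx hxI c
      refine ⟨w, ?_, hwd⟩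
      obtain ⟨p, hp, y, hy, rfl⟩ := Set.mem_add.1 hw
      obtain ⟨z, hz, g, hg, rfl⟩ := Set.mem_add.1 hp
      rw [mem_singleton_iff, history_now] at hz
      rw [mem_singleton_iff] at hy
      have hg' := hK ε _ hε (continuous_history hcont hxI.2) c g hg
      rw [history_now] at hg'
      have hy' : |y| ≤ C := by rw [hy]; exact hC x hxI c
      have hq := (abs_coord_le c (u x)).trans (hR x hxI)
      have hz' : |z| ≤ A * R := by
        rw [hz, abs_mul, abs_neg]
        exact mul_le_mul (hA c _ hq) hq (abs_nonneg _) hA0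
      have hg'' : |g| ≤ K * (1 + R) :=
        hg'.trans (mul_le_mul_of_nonneg_left (by linarith [hR x hxI]) hK0)
      exact (abs_add_le _ _).trans (add_le_add ((abs_add_le _ _).trans (add_le_add hz' hg'')) hy')
  refine LipschitzOnWith.of_dist_le_mul fun s hs t ht => ?_
  rw [Real.coe_toNNReal _ hL0]
  rcases le_total s t with h | h
  · rw [dist_comm, dist_comm s t, dist_eq_norm, Real.dist_eq, abs_of_nonneg (sub_nonneg.2 h)]
    exact key s hs t ht h
  · rw [dist_eq_norm, Real.dist_eq, abs_of_nonneg (sub_nonneg.2 h)]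
    exact key t ht s hs h

/-! ### Limits of solutions -/

/-- A limit of solutions, in the sense of uniform convergence on compact intervals, is a
solution as soon as it is Lipschitz on `[t₀, t₀ + T]`. -/
theorem isSolution_of_tendsto (hD : N.HypD) (hI : N.HypI)
    (hfin : ∀ p, IsFiniteMeasure (N.μ p)) (hT : 0 < T) {ε : ℕ → ℝ} {ε₀ : ℝ}
    (hε : ∀ m, ε m ∈ Icc (0 : ℝ) (1 / 5)) (hεl : Tendsto ε atTop (𝓝 ε₀))
    {φ : ℕ → Past → State n} (hφ : ∀ m, Continuous (φ m)) {φ₀ : Past → State n}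
    (hφ₀ : Continuous φ₀) {v : ℕ → ℝ → State n} (hv : ∀ m, N.IsSolution (ε m) t₀ T (φ m) (v m))
    (hu₀ : history u t₀ = φ₀) {L : NNReal} (hL : LipschitzOnWith L u (Icc t₀ (t₀ + T)))
    (hlim : ∀ a, TendstoUniformlyOn v u atTop (Icc a (t₀ + T))) :
    N.IsSolution ε₀ t₀ T φ₀ u := by
  have hT' : t₀ ≤ t₀ + T := by linarith
  have hε₀ : ε₀ ∈ Icc (0 : ℝ) (1 / 5) := isClosed_Icc.mem_of_tendsto hεl (Eventually.of_forall hε)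
  have hac : AbsolutelyContinuousOnInterval u t₀ (t₀ + T) :=
    LipschitzOnWith.absolutelyContinuousOnInterval (by rwa [uIcc_of_le hT'])
  have hucont : ContinuousOn u (Iic (t₀ + T)) :=
    continuousOn_Iic_of_history (by rwa [hu₀]) hL.continuousOn
  refine ⟨hu₀, hac, (ae_restrict_iff' measurableSet_Icc).2 ?_⟩
  have hdiff : ∀ᵐ t, ∀ c, t ∈ Icc t₀ (t₀ + T) →
      DifferentiableAt ℝ (fun s => coord c (u s)) t := by
    refine ae_all_iff.2 fun c => ?_
    have h1 : AbsolutelyContinuousOnInterval (fun s => coord c (u s)) t₀ (t₀ + T) :=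
      (lipschitzWith_coord c).comp_absolutelyContinuousOnInterval hac
    have h2 := h1.ae_differentiableAt
    rwa [uIcc_of_le hT'] at h2
  have hne : ∀ x : ℝ, ∀ᵐ t : ℝ, t ≠ x := fun x => by simp [ae_iff]
  filter_upwards [hdiff, hne t₀, hne (t₀ + T)] with t hd hne1 hne2 hmem
  have ht : t ∈ Ioo t₀ (t₀ + T) := ⟨lt_of_le_of_ne hmem.1 hne1.symm, lt_of_le_of_ne hmem.2 hne2⟩
  -- `HasDerivAt` is two-sided, hence the restriction to interior points.
  set w : State n := (fun i => deriv (fun s => coord (Sum.inl i) (u s)) t,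
    fun p => deriv (fun s => coord (Sum.inr p) (u s)) t) with hw
  have hwc : ∀ c, HasDerivAt (fun s => coord c (u s)) (coord c w) t := by
    intro c
    have := (hd c hmem).hasDerivAt
    cases c <;> exact this
  refine ⟨w, N.mem_rhs_iff.2 fun c => ?_, hasDerivAt_iff_coord.2 hwc⟩
  have hut : Continuous (history u t) := continuous_history hucont hmem.2
  obtain ⟨hcomp, hconv, hnon⟩ := rhs_compact_convex hfin hε₀ hut t c
  refine hasDerivAt_mem_of_tendstoUpper ht (fun m => (hv m).absolutelyContinuous_coord c)
    (fun s hs => ?_) (hwc c) (F := fun m s => N.rhs (ε m) s (history (v m) s) c) (fun m => ?_)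
    hcomp hconv hnon ?_
  · exact ((lipschitzWith_coord c).continuous.tendsto _).comp ((hlim t₀).tendsto_at hs)
  · filter_upwards [(hv m).ae_coord] with s hs hsm using hs hsm c
  · refine tendstoUpper_rhs (l := atTop ×ˢ 𝓝 t) (ε := fun p : ℕ × ℝ => ε p.1)
      (t := fun p : ℕ × ℝ => p.2) (w := fun p : ℕ × ℝ => history (v p.1) p.2) hD hI hfin
      (fun p => hε p.1) hε₀ (hεl.comp tendsto_fst) tendsto_snd ?_ hut (fun τ => ?_) c
    · filter_upwards [tendsto_snd.eventually (eventually_lt_nhds ht.2)] with p hp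
      exact continuous_history ((hv p.1).continuousOn hT (hφ p.1)) hp.le
    · have hτ : (τ : ℝ) ≤ 0 := τ.2
      have hlt : t + τ < t₀ + T := by linarith [ht.2]
      have hnhds : Icc (t + τ - 1) (t₀ + T) ∈ 𝓝 (t + τ) :=
        Icc_mem_nhds (by linarith) hlt
      refine tendsto_comp_of_locally_uniform_limit
        (F := fun p : ℕ × ℝ => v p.1) (g := fun p : ℕ × ℝ => p.2 + τ)
        (hucont.continuousAt (Iic_mem_nhds hlt)) (tendsto_snd.add_const _) fun W hW => ?_
      exact ⟨_, hnhds, tendsto_fst.eventually (hlim (t + τ - 1) W hW)⟩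

end Network

end DelayNetwork

theorem mainTheorem1 (n : ℕ) (γ : ℝ) (hγ : 0 < γ) (N : DelayNetwork.Network n)
    (hD : N.HypD) (hM : N.HypM γ) (hI : N.HypI)
    (t₀ T r : ℝ) (hT : 0 < T) (hr : 0 < r)
    (ε : ℕ → ℝ) (ε₀ : ℝ) (hε : ∀ m, ε m ∈ Set.Icc (0 : ℝ) (1 / 5))
    (hε_anti : Antitone ε) (hε_lim : Filter.Tendsto ε Filter.atTop (nhds ε₀))
    (φ : ℕ → DelayNetwork.CGamma γ (DelayNetwork.State n))
    (φ₀ : DelayNetwork.CGamma γ (DelayNetwork.State n))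
    (hφ_ball : ∀ m, DelayNetwork.gammaNorm (φ m) ≤ r)
    (hφ_lim : Filter.Tendsto (fun m => DelayNetwork.gammaNorm (φ m - φ₀)) Filter.atTop (nhds 0))
    (u : ℕ → ℝ → DelayNetwork.State n)
    (hu : ∀ m, N.IsSolution (ε m) t₀ T (φ m) (u m)) :
    ∃ (k : ℕ → ℕ) (uStar : ℝ → DelayNetwork.State n),
      StrictMono k ∧
      ContinuousOn uStar (Set.Icc t₀ (t₀ + T)) ∧
      TendstoUniformlyOn (fun l => u (k l)) uStar Filter.atTop (Set.Icc t₀ (t₀ + T)) ∧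
      N.IsSolution ε₀ t₀ T φ₀ uStar := by
  open DelayNetwork in
  have hfin := hM.isFiniteMeasure hγ
  have hT' : t₀ ≤ t₀ + T := by linarith
  have hnow : ∀ m, ‖(φ m : Past → State n) now‖ ≤ r := fun m => by
    have := norm_apply_le_gammaNorm (φ m) now
    simp only [now, mul_zero, neg_zero, Real.exp_zero, one_mul] at this
    exact this.trans (hφ_ball m)
  obtain ⟨R, hR⟩ := Network.exists_solution_bound hD hI hfin t₀ r hT
  obtain ⟨L, hL⟩ := Network.exists_solution_lipschitz hD hI hfin t₀ R hT
  have hbound := fun m => hR (ε m) (φ m) (u m) (hε m) (φ m).2.1 (hnow m) (hu m)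
  have hlip := fun m => hL (ε m) (φ m) (u m) (hε m) (φ m).2.1 (hu m) (hbound m)
  obtain ⟨k, g, hk, hg, hlim⟩ := exists_subseq_tendstoUniformlyOn_of_lipschitz hT' hbound hlip
  have hφk : Tendsto (fun l => gammaNorm (φ (k l) - φ₀)) atTop (𝓝 0) :=
    hφ_lim.comp hk.tendsto_atTop
  -- The initial datum and the uniform limit agree at `t₀`, so that they can be glued.
  have hg0 : g t₀ = (φ₀ : Past → State n) now := by
    refine tendsto_nhds_unique (hlim.tendsto_at (left_mem_Icc.2 hT')) ?_
    rw [tendsto_iff_norm_sub_tendsto_zero]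
    refine squeeze_zero (fun _ => norm_nonneg _) (fun l => ?_) hφk
    have h1 := norm_apply_le_gammaNorm (φ (k l) - φ₀) now
    have h2 : u (k l) t₀ = (φ (k l) : Past → State n) now := by
      rw [← (hu (k l)).1, history_now]
    rw [h2]
    simpa [now] using h1
  let w : ℝ → State n := fun t =>
    if h : t ≤ t₀ then (φ₀ : Past → State n) ⟨t - t₀, sub_nonpos.2 h⟩ else g t
  have hw0 : history w t₀ = φ₀ := by
    ext1 s
    have hs : (s : ℝ) ≤ 0 := s.2
    simp [history, w, hs]
  have hwg : EqOn g w (Icc t₀ (t₀ + T)) := by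
    intro t ht
    rcases ht.1.eq_or_lt with rfl | h
    · simp [w, hg0, now]
    · simp [w, not_le.2 h]
  have hwL : LipschitzOnWith L w (Icc t₀ (t₀ + T)) := fun x hx y hy => by
    rw [← hwg hx, ← hwg hy]
    exact hg hx hy
  have hwlim : TendstoUniformlyOn (fun l => u (k l)) w atTop (Icc t₀ (t₀ + T)) :=
    hlim.congr_right hwg
  exact ⟨k, w, hk, hwL.continuousOn, hwlim,
    Network.isSolution_of_tendsto hD hI hfin hT (fun l => hε (k l))
      (hε_lim.comp hk.tendsto_atTop) (fun l => (φ (k l)).2.1) φ₀.2.1 (fun l => hu (k l)) hw0 hwL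
      (tendstoUniformlyOn_Icc_of_history hγ (fun l => (hu (k l)).1) hw0 hφk hwlim)⟩
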